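/- Let $(W,S)$, $S=\{s_1,s_2,s_3,s_4\}$, be a Coxeter system of rank $4$ with Coxeter matrix $(m_{ij})$, i.e. $W=\langle s_1,\dots,s_4 \mid (s_is_j)^{m_{ij}}=1\rangle$ with $m_{ii}=1$ and $m_{ij}=m_{ji}\ge 2$ for $i\ne j$. Assume that all $m_{ij}$ are finite and odd, that $m_{1i}=5k_i$ for $2\le i\le 4$, where the $k_i$ are positive integers not divisible by $3$, and that $m_{ij}=3k_{ij}$ for $2\le i,j\le 4$, $i\neq j$, where the $k_{ij}$ are positive integers. Then $W$ has no finite index reflection subgroup; that is, there is no subgroup $V\subsetneq W$ of finite index that is generated by reflections (elements of $W$ conjugate in $W$ to elements of $S$). -/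

import Mathlib

/-- A Coxeter matrix is odd-angled if every entry is odd or infinite.
Mathlib encodes the value `∞` (no relation between the two generators) by `0`. -/
def CoxeterMatrix.IsOddAngled {B : Type*} (M : CoxeterMatrix B) : Prop :=
  ∀ i j : B, M i j = 0 ∨ Odd (M i j)

/-- A reflection subgroup of a Coxeter system: a proper subgroup generated by some set of
reflections, that is, of conjugates of simple generators. -/
def CoxeterSystem.IsReflectionSubgroup {B : Type*} {M : CoxeterMatrix B} {W : Type*} [Group W]
    (cs : CoxeterSystem M W) (V : Subgroup W) : Prop :=
  V ≠ ⊤ ∧ ∃ T : Set W, (∀ t ∈ T, cs.IsReflection t) ∧ V = Subgroup.closure T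

/-! View elements of `W` as chambers. Those not separated from 1 by a reflection in `V` form a set P
that meets each coset `V * w` in exactly one chamber, so P is finite when `V` has finite index. If
`V` is proper, P contains some simple reflection, so a longest chamber c of P is not 1 and has a
right descent. The contradiction is that c can have none.

Two facts collide. First, around a face of type {i, j}, if n consecutive chambers of P are bounded
by two walls whose reflections lie in `V`, the product of these reflections is a conjugate of `(s i
* s j) ^ n`. If n is prime to `M i j`, then `V` contains the whole local dihedral group, which is
absurd for n ≥ 2. So a sector of at least two chambers has at least three, and at least five if i or
j is 0 (`mul_mul_mem_fundamentalChambers`, `mul_mul_mul_mem_fundamentalChambers`). Stepping back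
from c and then sideways therefore stays in P, and maximality of the length forces many descents on
nearby chambers.

Second, a map to A₅ shows that no two simple reflections commute, and then no element has three
right descents (`not_isRightDescent_of_pair`). `isRightDescent_false_of_maximal` plays one fact
against the other. -/

open CoxeterSystem

/-! ### Identities in dihedral groups -/

section Dihedral

variable {G : Type*} [Group G] {a b : G}

theorem mul_pow_mul_comm_inv (ha : a * a = 1) (hb : b * b = 1) (n : ℕ) :
    b * (a * b) ^ n = ((a * b)⁻¹) ^ n * b := by
  induction n with
  | zero => simp
  | succ n ih =>
    have ha' : a⁻¹ = a := inv_eq_of_mul_eq_one_left ha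
    have hb' : b⁻¹ = b := inv_eq_of_mul_eq_one_left hb
    rw [pow_succ, ← mul_assoc, ih, pow_succ]
    simp only [mul_inv_rev, ha', hb', mul_assoc]

theorem mul_pow_conj_eq_right_iff (ha : a * a = 1) (hb : b * b = 1) (n : ℕ) (t : G) :
    (a * b) ^ n * t * ((a * b) ^ n)⁻¹ = b ↔ t = ((a * b)⁻¹) ^ (2 * n) * b := by
  rw [mul_inv_eq_iff_eq_mul, mul_pow_mul_comm_inv ha hb, two_mul, pow_add, ← eq_inv_mul_iff_mul_eq,
    ← inv_pow, mul_assoc]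

theorem mul_pow_conj_eq_left_iff (ha : a * a = 1) (hb : b * b = 1) (n : ℕ) (t : G) :
    b * ((a * b) ^ n * t * ((a * b) ^ n)⁻¹) * b = a ↔ t = ((a * b)⁻¹) ^ (2 * n + 1) * b := by
  have ha' : a⁻¹ = a := inv_eq_of_mul_eq_one_left ha
  have hb' : b⁻¹ = b := inv_eq_of_mul_eq_one_left hb
  have h : b * ((a * b) ^ n * t * ((a * b) ^ n)⁻¹) * b = a ↔
      (a * b) ^ n * t * ((a * b) ^ n)⁻¹ = (a * b)⁻¹ * b := by
    rw [mul_assoc b, ← eq_inv_mul_iff_mul_eq, ← eq_mul_inv_iff_mul_eq, mul_inv_rev, ha', hb']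
  rw [h, mul_inv_eq_iff_eq_mul, mul_assoc, mul_pow_mul_comm_inv ha hb, ← eq_inv_mul_iff_mul_eq,
    ← inv_pow, ← mul_assoc, ← mul_assoc, ← pow_succ, ← pow_add]
  ring_nf

end Dihedral

/-! ### Inversion parity and the exchange condition -/

namespace CoxeterSystem

variable {B : Type*} {M : CoxeterMatrix B} {W : Type*} [Group W] (cs : CoxeterSystem M W)

local prefix:100 "s" => cs.simple
local prefix:100 "ℓ" => cs.length

open Classical in
/-- The action of a simple reflection on signed elements of `W`: conjugation on the element, with
the sign flipped exactly at the simple reflection itself. -/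
noncomputable def signedConj (i : B) : Function.End (W × ZMod 2) :=
  fun p ↦ (s i * p.1 * s i, p.2 + if p.1 = s i then 1 else 0)

open Classical in
theorem signedConj_mul_pow_apply (i j : B) (n : ℕ) (t : W) (e : ZMod 2) :
    ((cs.signedConj i * cs.signedConj j) ^ n) (t, e) =
      ((s i * s j) ^ n * t * ((s i * s j) ^ n)⁻¹,
        e + ∑ k ∈ Finset.range (2 * n), if t = ((s i * s j)⁻¹) ^ k * s j then 1 else 0) := by
  induction n with
  | zero => simp; rfl
  | succ n ih =>
    have hi := cs.simple_mul_simple_self i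
    have hj := cs.simple_mul_simple_self j
    rw [pow_succ']
    change cs.signedConj i (cs.signedConj j (((cs.signedConj i * cs.signedConj j) ^ n) (t, e))) = _
    rw [ih, show 2 * (n + 1) = 2 * n + 1 + 1 by ring, Finset.sum_range_succ, Finset.sum_range_succ]
    simp only [signedConj, mul_pow_conj_eq_right_iff hi hj, mul_pow_conj_eq_left_iff hi hj]
    refine Prod.ext ?_ ?_
    · simp [pow_succ', mul_assoc]
    · simp only [add_assoc]

/-- The powers of `(s i * s j)⁻¹` are periodic with period `M i j`, so each sign flip in the sum of
`2 * M i j` terms occurs twice and cancels. -/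
theorem isLiftable_signedConj : M.IsLiftable cs.signedConj := by
  classical
  intro i j
  funext p
  obtain ⟨t, e⟩ := p
  rw [signedConj_mul_pow_apply, cs.simple_mul_simple_pow, two_mul, Finset.sum_range_add]
  have h : ∀ k, ((s i * s j)⁻¹) ^ (M i j + k) = ((s i * s j)⁻¹) ^ k := fun k ↦ by
    rw [pow_add, inv_pow, cs.simple_mul_simple_pow, inv_one, one_mul]
  simp only [h, CharTwo.add_self_eq_zero, one_mul, inv_one, mul_one, add_zero]
  rfl

/-- The parity of the number of occurrences of `t` in the right inversion sequence of any word
for `w`. -/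
noncomputable def inversionParity (w t : W) : ZMod 2 :=
  (cs.lift ⟨cs.signedConj, cs.isLiftable_signedConj⟩ w (t, 0)).2

local notation "η" => cs.inversionParity

theorem lift_signedConj_apply (w t : W) (e : ZMod 2) :
    cs.lift ⟨cs.signedConj, cs.isLiftable_signedConj⟩ w (t, e) =
      (w * t * w⁻¹, e + η w t) := by
  induction w using cs.simple_induction_left generalizing t e with
  | one => 
    simp only [map_one, one_mul, inv_one, mul_one, inversionParity]
    change (t, e) = (t, e + 0)
    simp
  | mul_simple_left w i ih =>
    have key : ∀ e, cs.lift ⟨cs.signedConj, cs.isLiftable_signedConj⟩ (s i * w) (t, e) =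
        cs.signedConj i (w * t * w⁻¹, e + η w t) := fun e ↦ by
      rw [map_mul, lift_apply_simple]
      change cs.signedConj i (cs.lift ⟨cs.signedConj, cs.isLiftable_signedConj⟩ w (t, e)) = _
      rw [ih]
    rw [inversionParity, key, key]
    simp [signedConj, mul_assoc, add_assoc]

theorem inversionParity_mul (u v t : W) : η (u * v) t = η v t + η u (v * t * v⁻¹) := by
  have h := cs.lift_signedConj_apply (u * v) t 0
  rw [map_mul] at h
  change cs.lift ⟨cs.signedConj, cs.isLiftable_signedConj⟩ u
    (cs.lift ⟨cs.signedConj, cs.isLiftable_signedConj⟩ v (t, 0)) = _ at h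
  rw [lift_signedConj_apply, lift_signedConj_apply] at h
  simpa using (congrArg Prod.snd h).symm

@[simp] theorem inversionParity_one (t : W) : η 1 t = 0 := by
  simpa using cs.inversionParity_mul 1 1 t

open Classical in
theorem inversionParity_simple (i : B) (t : W) : η (s i) t = if t = s i then 1 else 0 := by
  rw [inversionParity, lift_apply_simple]
  simp [signedConj]

theorem inversionParity_inv_add (w t : W) : η w⁻¹ t + η w (w⁻¹ * t * w) = 0 := by
  simpa using (cs.inversionParity_mul w w⁻¹ t).symm

theorem inversionParity_inv (w t : W) : η w (w⁻¹ * t * w) = η w⁻¹ t := by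
  have h := cs.inversionParity_inv_add w t
  rw [CharTwo.add_eq_zero] at h
  exact h.symm

theorem IsReflection.inversionParity_self {t : W} (ht : cs.IsReflection t) : η t t = 1 := by
  classical
  obtain ⟨w, i, rfl⟩ := ht
  have h := cs.inversionParity_inv w (w * s i * w⁻¹)
  rw [show w⁻¹ * (w * s i * w⁻¹) * w = s i by group] at h
  rw [inversionParity_mul, inversionParity_mul, inversionParity_simple,
    show w⁻¹ * (w * s i * w⁻¹) * w⁻¹⁻¹ = s i by group, if_pos rfl,
    show s i * s i * (s i)⁻¹ = s i by group, h]
  generalize η w⁻¹ _ = x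
  revert x
  decide

theorem IsReflection.inversionParity_mul_self {t : W} (ht : cs.IsReflection t) (w : W) :
    η (w * t) t = 1 + η w t := by
  rw [inversionParity_mul, IsReflection.inversionParity_self cs ht]
  simp

theorem zmod_two_eq_one_iff (x : ZMod 2) : x = 1 ↔ x ≠ 0 := by revert x; decide

/-- The exchange condition for words in a set of involutions on which the inversion parity
is as small as possible. -/
theorem exists_shorter_list_of_inversionParity {K : Set W}
    (hK : ∀ r ∈ K, r * r = 1) (V : Subgroup W) (hKV : K ⊆ V)
    (hη : ∀ r ∈ K, ∀ t ∈ V, η r t = 1 → t = r) (l : List W) (hl : ∀ r ∈ l, r ∈ K) (t : W)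
    (htV : t ∈ V) (h : η l.prod t = 1) :
    ∃ l' : List W, (∀ r ∈ l', r ∈ K) ∧ l'.length + 1 = l.length ∧ l.prod * t = l'.prod := by
  induction l with
  | nil => simp at h
  | cons r l ih =>
    have hlK : ∀ r ∈ l, r ∈ K := fun r hr ↦ hl r (List.mem_cons_of_mem _ hr)
    have hr : r ∈ K := hl r List.mem_cons_self
    have hlV : l.prod ∈ V := list_prod_mem fun x hx ↦ hKV (hlK x hx)
    by_cases h1 : η l.prod t = 1
    · obtain ⟨l', h1, h2, h3⟩ := ih hlK h1
      refine ⟨r :: l', ?_, by simp [h2], by simp [mul_assoc, h3]⟩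
      simpa [hr] using h1
    · rw [List.prod_cons, inversionParity_mul] at h
      rw [zmod_two_eq_one_iff, not_not] at h1
      rw [h1, zero_add] at h
      have h2 := hη r hr _ (V.mul_mem (V.mul_mem hlV htV) (V.inv_mem hlV)) h
      refine ⟨l, hlK, by simp, ?_⟩
      have h3 : l.prod * t = r * l.prod := by rw [← h2]; group
      rw [List.prod_cons, mul_assoc, h3, ← mul_assoc, hK r hr, one_mul]

theorem wordProd_eq_prod (ω : List B) : cs.wordProd ω = (ω.map cs.simple).prod := rfl

theorem length_list_prod_le (l : List W) (hl : ∀ r ∈ l, r ∈ Set.range cs.simple) :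
    ℓ l.prod ≤ l.length := by
  induction l with
  | nil => simp
  | cons r l ih =>
    obtain ⟨i, rfl⟩ := hl r List.mem_cons_self
    have := ih fun r hr ↦ hl r (List.mem_cons_of_mem _ hr)
    have := cs.length_mul_le (s i) l.prod
    rw [cs.length_simple] at this
    simp only [List.prod_cons, List.length_cons]
    lia

theorem length_mul_lt_of_inversionParity {w t : W} (h : η w t = 1) : ℓ (w * t) < ℓ w := by
  classical
  obtain ⟨ω, hω, rfl⟩ := cs.exists_isReduced w
  obtain ⟨l', h1, h2, h3⟩ := cs.exists_shorter_list_of_inversionParity (K := Set.range cs.simple)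
    (by rintro _ ⟨i, rfl⟩; simp) ⊤ (by simp)
    (by rintro _ ⟨i, rfl⟩ t _ h; by_contra h'; simp [inversionParity_simple, h'] at h)
    (ω.map cs.simple) (by simp) t trivial h
  have := cs.length_list_prod_le l' h1
  rw [hω.eq, wordProd_eq_prod, h3]
  simp at h2
  lia

theorem IsReflection.inversionParity_eq_one_iff {t : W} (ht : cs.IsReflection t) (w : W) :
    η w t = 1 ↔ ℓ (w * t) < ℓ w := by
  refine ⟨cs.length_mul_lt_of_inversionParity, fun h ↦ ?_⟩
  rw [zmod_two_eq_one_iff]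
  intro h0
  have h1 := IsReflection.inversionParity_mul_self cs ht w
  rw [h0, add_zero] at h1
  have h2 := cs.length_mul_lt_of_inversionParity h1
  rw [mul_assoc, ht.mul_self, mul_one] at h2
  lia

theorem inversionParity_simple_eq_one_iff (w : W) (i : B) :
    η w (s i) = 1 ↔ cs.IsRightDescent w i :=
  IsReflection.inversionParity_eq_one_iff cs (cs.isReflection_simple i) w

end CoxeterSystem

theorem exists_minimal_list_of_mem_closure {G : Type*} [Group G] {K : Set G}
    (hK : ∀ r ∈ K, r * r = 1) {v : G} (hv : v ∈ Subgroup.closure K) :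
    ∃ l : List G, (∀ r ∈ l, r ∈ K) ∧ l.prod = v ∧
      ∀ l' : List G, (∀ r ∈ l', r ∈ K) → l'.prod = v → l.length ≤ l'.length := by
  have hex : ∃ n, ∃ l : List G, (∀ r ∈ l, r ∈ K) ∧ l.prod = v ∧ l.length = n := by
    have hKi : K⁻¹ ⊆ K := fun r hr ↦ by
      rwa [← inv_inv r, inv_eq_of_mul_eq_one_left (hK _ hr)]
    rw [← Subgroup.mem_toSubmonoid, Subgroup.closure_toSubmonoid,
      Set.union_eq_self_of_subset_right hKi] at hv
    obtain ⟨l, hl, rfl⟩ := Submonoid.exists_list_of_mem_closure hv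
    exact ⟨_, l, hl, rfl, rfl⟩
  classical
  obtain ⟨l, h1, h2, h3⟩ := Nat.find_spec hex
  exact ⟨l, h1, h2, fun l' h1' h2' ↦ h3 ▸ Nat.find_min' hex ⟨l', h1', h2', rfl⟩⟩

/-! ### Pairs of right descents and dihedral subgroups -/

namespace CoxeterSystem

variable {B : Type*} {M : CoxeterMatrix B} {W : Type*} [Group W] (cs : CoxeterSystem M W)

local prefix:100 "s" => cs.simple
local prefix:100 "ℓ" => cs.length
local notation "η" => cs.inversionParity

/-- Otherwise r would already be inverted by `l.prod`, and the exchange condition would give a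
shorter word for `l.prod * r`. -/
theorem inversionParity_mul_last {K : Set W} (hK : ∀ r ∈ K, cs.IsReflection r) (V : Subgroup W)
    (hKV : K ⊆ V) (hη : ∀ r ∈ K, ∀ t ∈ V, η r t = 1 → t = r) (l : List W)
    (hl : ∀ r ∈ l, r ∈ K) (r : W) (hr : r ∈ K)
    (hmin : ∀ l' : List W, (∀ r ∈ l', r ∈ K) → l'.prod = l.prod * r → l.length < l'.length) :
    η (l.prod * r) r = 1 := by
  rw [IsReflection.inversionParity_mul_self cs (hK r hr), add_eq_left]
  by_contra h
  rw [← ne_eq, ← zmod_two_eq_one_iff] at h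
  obtain ⟨l', h1, h2, h3⟩ := cs.exists_shorter_list_of_inversionParity
    (fun r hr ↦ (hK r hr).mul_self) V hKV hη l hl r (hKV hr) h
  have := hmin l' h1 h3.symm
  lia

theorem inversionParity_alternating {i j : B} (hij : (s i * s j) ^ 2 ≠ 1) {g : W}
    (hg : g ∈ Subgroup.closure {s i, s j}) (hi : η g (s i) = 1) (hj : η g (s j) = 1) :
    η (g * s i) (s j) = 1 ∧ η (g * s i * s j) (s i) = 1 := by
  classical
  set K : Set W := {s i, s j} with hK
  set G : Subgroup W := Subgroup.closure K with hG
  have hKG : K ⊆ G := Subgroup.subset_closure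
  have hiK : s i ∈ K := by simp [hK]
  have hjK : s j ∈ K := by simp [hK]
  have hKrefl : ∀ r ∈ K, cs.IsReflection r := by
    rintro r (rfl | rfl) <;> exact cs.isReflection_simple _
  have hKη : ∀ r ∈ K, ∀ t ∈ G, η r t = 1 → t = r := by
    rintro r (rfl | rfl) t - h <;> by_contra h' <;> simp [inversionParity_simple, h'] at h
  have hne : s j ≠ s i := fun h ↦ hij (by simp [h])
  have hbraid : s i * s j * s i ≠ s j := fun h ↦ hij (by
    rw [pow_two, ← mul_assoc, h, cs.simple_mul_simple_self])
  obtain ⟨l₀, hl₀, rfl, hmin⟩ := exists_minimal_list_of_mem_closure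
    (fun r hr ↦ (hKrefl r hr).mul_self) hg
  obtain ⟨l, hl, hlen, hprod⟩ := cs.exists_shorter_list_of_inversionParity
    (fun r hr ↦ (hKrefl r hr).mul_self) G hKG hKη l₀ hl₀ (s i) (hKG hiK) hi
  have hprod' : l₀.prod = l.prod * s i := by rw [← hprod]; simp
  rcases List.eq_nil_or_concat' l with rfl | ⟨l₁, r, rfl⟩
  · simp [hprod', inversionParity_simple, hne] at hj
  have hl₁ : ∀ r ∈ l₁, r ∈ K := fun x hx ↦ hl x (by simp [hx])
  have hr : r ∈ K := hl r (by simp)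
  simp only [List.prod_append, List.prod_cons, List.prod_nil, mul_one, List.length_append,
    List.length_cons, List.length_nil] at hprod hprod' hlen
  rcases hr with rfl | rfl
  · have := hmin l₁ hl₁ (by rw [hprod']; simp)
    lia
  have hfirst : η (l₀.prod * s i) (s j) = 1 := by
    rw [hprod]
    refine cs.inversionParity_mul_last hKrefl G hKG hKη l₁ hl₁ _ hjK fun l' h1 h2 ↦ ?_
    have := hmin (l' ++ [s i]) (by simpa [or_imp, forall_and, hiK] using h1)
      (by simp [h2, hprod'])
    simp at this
    lia
  refine ⟨hfirst, ?_⟩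
  rcases List.eq_nil_or_concat' l₁ with rfl | ⟨l₂, r, rfl⟩
  -- The word `s j * s i` does not invert `s j`, because the two reflections do not commute.
  · simp [hprod', inversionParity_mul, inversionParity_simple, hne, hbraid] at hj
  have hl₂ : ∀ r ∈ l₂, r ∈ K := fun x hx ↦ hl₁ x (by simp [hx])
  have hr : r ∈ K := hl₁ r (by simp)
  simp only [List.prod_append, List.prod_cons, List.prod_nil, mul_one, List.length_append,
    List.length_cons, List.length_nil] at hprod hprod' hlen
  rcases hr with rfl | rfl
  · rw [hprod, cs.simple_mul_simple_cancel_right]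
    refine cs.inversionParity_mul_last hKrefl G hKG hKη l₂ hl₂ _ hiK fun l' h1 h2 ↦ ?_
    have := hmin (l' ++ [s j, s i]) (by simpa [or_imp, forall_and, hiK, hjK] using h1)
      (by simp [h2, hprod', mul_assoc])
    simp at this
    lia
  · have := hmin (l₂ ++ [s i]) (by simpa [or_imp, forall_and, hiK] using hl₂)
      (by rw [hprod']; simp)
    simp at this
    lia

/-- If `i ≠ j` are right descents of `w` and `(s i * s j) ^ 2 ≠ 1`, then one can descend from `w`
by three alternating steps. -/
theorem IsRightDescent.alternating {w : W} {i j : B} (hij : (s i * s j) ^ 2 ≠ 1)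
    (hi : cs.IsRightDescent w i) (hj : cs.IsRightDescent w j) :
    cs.IsRightDescent (w * s i) j ∧ cs.IsRightDescent (w * s i * s j) i := by
  set G : Subgroup W := Subgroup.closure {s i, s j} with hG
  have hiG : s i ∈ G := Subgroup.subset_closure (by simp)
  have hjG : s j ∈ G := Subgroup.subset_closure (by simp)
  have hex : ∃ n, ∃ u ∈ G, ℓ (w * u) = n := ⟨_, 1, G.one_mem, rfl⟩
  classical
  obtain ⟨u, huG, hu⟩ := Nat.find_spec hex
  -- The shortest element `w * u` of the coset inverts no reflection of `G`, so the descents of `w *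
  -- g` in directions i, j are those of `u⁻¹ * g` in the dihedral group.
  have hmin : ∀ g ∈ G, ℓ (w * u) ≤ ℓ (w * g) := fun g hg ↦
    hu ▸ Nat.find_min' hex ⟨g, hg, rfl⟩
  have key : ∀ g ∈ G, ∀ k, s k ∈ G → η (w * g) (s k) = η (u⁻¹ * g) (s k) := by
    intro g hg k hk
    have h := cs.inversionParity_mul (w * u) (u⁻¹ * g) (s k)
    rw [show w * u * (u⁻¹ * g) = w * g by group] at h
    rw [h, add_eq_left]
    by_contra h0
    rw [← ne_eq, ← zmod_two_eq_one_iff] at h0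
    have hug := G.mul_mem (G.inv_mem huG) hg
    have := cs.length_mul_lt_of_inversionParity h0
    have := hmin (u * (u⁻¹ * g * s k * (u⁻¹ * g)⁻¹))
      (G.mul_mem huG (G.mul_mem (G.mul_mem hug hk) (G.inv_mem hug)))
    rw [← mul_assoc] at this
    lia
  simp only [← inversionParity_simple_eq_one_iff] at hi hj ⊢
  have h1 := key 1 G.one_mem
  rw [mul_one, mul_one] at h1
  rw [h1 i hiG] at hi
  rw [h1 j hjG] at hj
  rw [key _ hiG j hjG, mul_assoc, key _ (G.mul_mem hiG hjG) i hiG, ← mul_assoc]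
  exact cs.inversionParity_alternating hij (G.inv_mem huG) hi hj

end CoxeterSystem

/-! ### Descents without commuting generators; fundamental chambers of a reflection subgroup -/

namespace CoxeterSystem

variable {B : Type*} {M : CoxeterMatrix B} {W : Type*} [Group W] (cs : CoxeterSystem M W)

local prefix:100 "s" => cs.simple
local prefix:100 "ℓ" => cs.length
local notation "η" => cs.inversionParity

theorem not_isRightDescent_mul_simple {w : W} {i : B} (h : cs.IsRightDescent w i) :
    ¬ cs.IsRightDescent (w * s i) i :=
  (cs.isRightDescent_iff_not_isRightDescent_mul).1 h

theorem isRightDescent_mul_simple {w : W} {i : B} (h : ¬ cs.IsRightDescent w i) :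
    cs.IsRightDescent (w * s i) i :=
  not_not.1 fun h' ↦ h ((cs.isRightDescent_iff_not_isRightDescent_mul).2 h')

/-- If no two distinct simple reflections commute and `w` has right descents `i ≠ j`, then `j` is
the only right descent of `w * s i`. -/
theorem eq_of_isRightDescent_mul_simple (H : ∀ i j : B, i ≠ j → (s i * s j) ^ 2 ≠ 1) {w : W}
    {i j k : B} (hij : i ≠ j) (hi : cs.IsRightDescent w i) (hj : cs.IsRightDescent w j)
    (hk : cs.IsRightDescent (w * s i) k) : k = j := by
  induction hn : ℓ w using Nat.strong_induction_on generalizing w i j k with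
  | _ n ih =>
    by_contra hkj
    obtain ⟨h1, h2⟩ := IsRightDescent.alternating cs (H i j hij) hi hj
    have h3 := ih _ (hn ▸ hi) (Ne.symm hkj) h1 hk h2 rfl
    exact cs.not_isRightDescent_mul_simple hi (h3 ▸ hk)

theorem not_isRightDescent_of_pair (H : ∀ i j : B, i ≠ j → (s i * s j) ^ 2 ≠ 1) {w : W}
    {i j k : B} (hij : i ≠ j) (hik : i ≠ k) (hjk : j ≠ k) (hi : cs.IsRightDescent w i)
    (hj : cs.IsRightDescent w j) : ¬ cs.IsRightDescent w k := fun hk ↦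
  hjk (cs.eq_of_isRightDescent_mul_simple H hij hi hj
    (IsRightDescent.alternating cs (H i k hik) hi hk).1).symm

theorem length_mul_simple_mul_simple (H : ∀ i j : B, i ≠ j → (s i * s j) ^ 2 ≠ 1) {w : W}
    {i j : B} (hij : i ≠ j) (hi : ¬ cs.IsRightDescent w i) (hj : ¬ cs.IsRightDescent w j) :
    ℓ (w * s i * s j) = ℓ w + 2 := by
  have h : ¬ cs.IsRightDescent (w * s i) j := fun h ↦ hj (by
    simpa using (IsRightDescent.alternating cs (H i j hij) (cs.isRightDescent_mul_simple hi) h).1)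
  rw [cs.not_isRightDescent_iff.1 h, cs.not_isRightDescent_iff.1 hi]

/-- The elements of `W`, viewed as chambers, that are not separated from the identity by any
reflection of the subgroup `V`. -/
def fundamentalChambers (V : Subgroup W) : Set W := {p | ∀ t ∈ V, η p⁻¹ t = 0}

theorem one_mem_fundamentalChambers (V : Subgroup W) : 1 ∈ cs.fundamentalChambers V := by
  intro t _
  simp

/-- The reflections in the walls of the fundamental chambers of `V`. -/
def wallReflections (V : Subgroup W) : Set W :=
  {r | r ∈ V ∧ ∃ p ∈ cs.fundamentalChambers V, ∃ i, r = p * s i * p⁻¹}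

variable {cs} {V : Subgroup W}

-- Passing from p to the adjacent chamber crosses a single wall, that of `p * s i * p⁻¹`; no other
-- parity changes.
open Classical in
theorem mul_simple_mem_fundamentalChambers_iff {p : W} (hp : p ∈ cs.fundamentalChambers V) (i : B) :
    p * s i ∈ cs.fundamentalChambers V ↔ p * s i * p⁻¹ ∉ V := by
  have key : ∀ t ∈ V, η (p * s i)⁻¹ t = if t = p * s i * p⁻¹ then 1 else 0 := fun t ht ↦ by
    rw [mul_inv_rev, cs.inv_simple, inversionParity_mul, hp t ht, zero_add, inversionParity_simple]
    congr 1
    rw [inv_inv, eq_mul_inv_iff_mul_eq, mul_assoc, inv_mul_eq_iff_eq_mul]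
  constructor
  · intro h h'
    have := h _ h'
    rw [key _ h', if_pos rfl] at this
    exact one_ne_zero this
  · intro h t ht
    rw [key t ht, if_neg]
    rintro rfl
    exact h ht

theorem mul_simple_mem_fundamentalChambers {p : W} (hp : p ∈ cs.fundamentalChambers V) {i : B}
    (h : cs.IsRightDescent p i) : p * s i ∈ cs.fundamentalChambers V := by
  rw [mul_simple_mem_fundamentalChambers_iff hp]
  intro h'
  have h1 := hp _ h'
  rw [← inversionParity_inv, show p⁻¹ * (p * s i * p⁻¹) * p = s i by group,
    (cs.inversionParity_simple_eq_one_iff p i).2 h] at h1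
  exact one_ne_zero h1

theorem isReflection_of_mem_wallReflections {r : W} (hr : r ∈ cs.wallReflections V) :
    cs.IsReflection r := by
  obtain ⟨-, p, -, i, rfl⟩ := hr
  exact ⟨p, i, rfl⟩

theorem exists_eq_mul_fundamentalChamber (w : W) :
    ∃ v ∈ Subgroup.closure (cs.wallReflections V), ∃ p ∈ cs.fundamentalChambers V, w = v * p := by
  induction w using cs.simple_induction_right with
  | one => exact ⟨1, one_mem _, 1, cs.one_mem_fundamentalChambers V, by simp⟩
  | mul_simple_right w i ih =>
    obtain ⟨v, hv, p, hp, rfl⟩ := ih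
    by_cases h : p * s i ∈ cs.fundamentalChambers V
    · exact ⟨v, hv, _, h, mul_assoc _ _ _⟩
    · have hV : p * s i * p⁻¹ ∈ V := by
        rwa [mul_simple_mem_fundamentalChambers_iff hp, not_not] at h
      exact ⟨v * (p * s i * p⁻¹), mul_mem hv (Subgroup.subset_closure ⟨hV, p, hp, i, rfl⟩), p, hp,
        by group⟩

theorem closure_wallReflections {T : Set W} (hT : ∀ t ∈ T, cs.IsReflection t)
    (hV : V = Subgroup.closure T) : Subgroup.closure (cs.wallReflections V) = V := by
  have hle : Subgroup.closure (cs.wallReflections V) ≤ V :=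
    (Subgroup.closure_le V).2 fun r hr ↦ hr.1
  refine le_antisymm hle ?_
  conv_lhs => rw [hV]
  rw [Subgroup.closure_le]
  intro t ht
  have htV : t ∈ V := hV ▸ Subgroup.subset_closure ht
  obtain ⟨w, i, rfl⟩ := hT t ht
  obtain ⟨v, hv, p, hp, rfl⟩ := exists_eq_mul_fundamentalChamber (cs := cs) (V := V) w
  have h1 : p * s i * p⁻¹ ∈ V := by
    have := V.mul_mem (V.mul_mem (V.inv_mem (hle hv)) htV) (hle hv)
    convert this using 1
    group
  have h2 := mul_mem (mul_mem hv (Subgroup.subset_closure (k := cs.wallReflections V)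
    ⟨h1, p, hp, i, rfl⟩)) (inv_mem hv)
  change _ ∈ Subgroup.closure _
  convert h2 using 1
  group

theorem eq_of_inversionParity_wallReflection {r : W} (hr : r ∈ cs.wallReflections V) {t : W}
    (ht : t ∈ V) (h : η r t = 1) : t = r := by
  classical
  obtain ⟨hrV, p, hp, i, rfl⟩ := hr
  rw [inversionParity_mul, hp t ht, zero_add, inversionParity_mul, inversionParity_simple] at h
  have h1 : η p (s i * (p⁻¹ * t * p⁻¹⁻¹) * (s i)⁻¹) = 0 := by
    have := hp _ (V.mul_mem (V.mul_mem hrV ht) (V.inv_mem hrV))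
    rw [← inversionParity_inv] at this
    rw [← this]
    congr 1
    group
  rw [h1, add_zero, inv_inv] at h
  by_cases h2 : p⁻¹ * t * p = s i
  · rw [← h2]; group
  · simp [h2] at h

/-- The last letter of a shortest nonempty word in the wall reflections would be a reflection of `V`
inverted by v. -/
theorem eq_one_of_mem_fundamentalChambers {T : Set W} (hT : ∀ t ∈ T, cs.IsReflection t)
    (hV : V = Subgroup.closure T) {v : W} (hv : v ∈ V) (h : ∀ t ∈ V, η v t = 0) : v = 1 := by
  have hKV : cs.wallReflections V ⊆ V := fun r hr ↦ hr.1
  rw [← closure_wallReflections hT hV] at hv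
  obtain ⟨l, hl, rfl, hmin⟩ := exists_minimal_list_of_mem_closure
    (fun r hr ↦ (isReflection_of_mem_wallReflections hr).mul_self) hv
  rcases List.eq_nil_or_concat' l with rfl | ⟨l, r, rfl⟩
  · rfl
  have hr := hl r (by simp)
  have h1 := cs.inversionParity_mul_last (fun r hr ↦ isReflection_of_mem_wallReflections hr) V hKV
    (fun r hr t ht ↦ eq_of_inversionParity_wallReflection hr ht) l (fun x hx ↦ hl x (by simp [hx]))
    r hr fun l' h1 h2 ↦ by
      have := hmin l' h1 (by simpa using h2)
      simp at this
      lia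
  have h2 := h r (hKV hr)
  simp [h1] at h2

theorem finite_fundamentalChambers {T : Set W} (hT : ∀ t ∈ T, cs.IsReflection t)
    (hV : V = Subgroup.closure T) [V.FiniteIndex] : (cs.fundamentalChambers V).Finite := by
  refine Set.Finite.of_injOn (f := fun p ↦ (QuotientGroup.mk p⁻¹ : W ⧸ V)) (t := Set.univ)
    (fun _ _ ↦ trivial) ?_ Set.finite_univ
  intro p hp q hq hpq
  have hv : p * q⁻¹ ∈ V := by simpa using QuotientGroup.eq.1 hpq
  have h : p * q⁻¹ = 1 := eq_one_of_mem_fundamentalChambers hT hV hv fun t ht ↦ by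
    rw [inversionParity_mul, hq t ht, zero_add, inv_inv]
    have := hp (p * (q⁻¹ * t * q) * p⁻¹) (by
      convert V.mul_mem (V.mul_mem hv ht) (V.inv_mem hv) using 1
      group)
    rw [← inversionParity_inv] at this
    rw [← this]
    congr 1
    group
  exact mul_inv_eq_one.1 h

theorem simple_conj_mem_of_pow_mem {p : W} {i j : B} {n : ℕ} (hn : n.Coprime (M i j))
    (hj : p * s j * p⁻¹ ∈ V) (h : p * (s i * s j) ^ n * p⁻¹ ∈ V) : p * s i * p⁻¹ ∈ V := by
  have hm : (p * (s i * s j) * p⁻¹) ^ M i j = 1 := by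
    rw [conj_pow, cs.simple_mul_simple_pow]; simp
  obtain ⟨k, hk⟩ := exists_pow_eq_self_of_coprime (hn.coprime_dvd_right (orderOf_dvd_of_pow_eq_one hm))
  have h1 : p * (s i * s j) * p⁻¹ ∈ V := by
    rw [← hk, conj_pow]
    exact V.pow_mem h k
  convert V.mul_mem h1 hj using 1
  simp [mul_assoc]

/-- Around a codimension-two face of odd order, the fundamental chambers do not form a sector
of exactly two chambers. -/
theorem mul_mul_mem_fundamentalChambers {p : W} {i j : B} (hodd : Odd (M i j))
    (hp : p ∈ cs.fundamentalChambers V) (hj : p * s j ∉ cs.fundamentalChambers V)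
    (hi : p * s i ∈ cs.fundamentalChambers V) : p * s i * s j ∈ cs.fundamentalChambers V := by
  rw [mul_simple_mem_fundamentalChambers_iff hi]
  intro h
  rw [mul_simple_mem_fundamentalChambers_iff hp, not_not] at hj
  refine (mul_simple_mem_fundamentalChambers_iff hp i).1 hi
    (simple_conj_mem_of_pow_mem (n := 2) (by simpa using hodd) hj ?_)
  convert V.mul_mem h hj using 1
  simp [mul_assoc, pow_succ]

/-- Around a codimension-two face whose order is prime to `6`, a sector of at least two fundamental
chambers has at least five chambers. -/
theorem mul_mul_mul_mem_fundamentalChambers {p : W} {i j : B} (hodd : Odd (M i j))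
    (h3 : ¬ 3 ∣ M i j) (hp : p ∈ cs.fundamentalChambers V)
    (hj : p * s j ∉ cs.fundamentalChambers V) (hi : p * s i ∈ cs.fundamentalChambers V) :
    p * s i * s j * s i ∈ cs.fundamentalChambers V ∧
      p * s i * s j * s i * s j ∈ cs.fundamentalChambers V := by
  have h2 := mul_mul_mem_fundamentalChambers hodd hp hj hi
  rw [mul_simple_mem_fundamentalChambers_iff hp, not_not] at hj
  have hi' := (mul_simple_mem_fundamentalChambers_iff hp i).1 hi
  have h : p * s i * s j * s i ∈ cs.fundamentalChambers V := by
    rw [mul_simple_mem_fundamentalChambers_iff h2]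
    intro h
    refine hi' (simple_conj_mem_of_pow_mem (n := 3)
      ((Nat.Prime.coprime_iff_not_dvd Nat.prime_three).2 h3) hj ?_)
    convert V.mul_mem h hj using 1
    simp [mul_assoc, pow_succ]
  refine ⟨h, ?_⟩
  rw [mul_simple_mem_fundamentalChambers_iff h]
  intro h'
  refine hi' (simple_conj_mem_of_pow_mem (n := 4)
    (Nat.Coprime.pow_left 2 (by simpa using hodd : Nat.Coprime 2 (M i j))) hj ?_)
  convert V.mul_mem h' hj using 1
  simp [mul_assoc, pow_succ]

end CoxeterSystem

/-! ### Noncommuting generators and the extremal argument -/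

namespace CoxeterSystem

variable {W : Type*} [Group W] {M : CoxeterMatrix (Fin 4)} (cs : CoxeterSystem M W)

local prefix:100 "s" => cs.simple
local prefix:100 "ℓ" => cs.length

open Equiv in
/-- A homomorphism onto a subgroup of `A₅` shows that no two simple reflections commute. -/
theorem simple_mul_simple_sq_ne_one (h5 : ∀ i : Fin 4, i ≠ 0 → 5 ∣ M 0 i)
    (h3 : ∀ i j : Fin 4, i ≠ 0 → j ≠ 0 → i ≠ j → 3 ∣ M i j) {i j : Fin 4} (hij : i ≠ j) :
    (s i * s j) ^ 2 ≠ 1 := by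
  let a : Perm (Fin 5) := swap 1 2 * swap 3 4
  let b : Perm (Fin 5) := swap 0 1 * swap 2 3
  let c : Perm (Fin 5) := swap 0 4 * swap 2 3
  have haa : a * a = 1 := by decide
  have hbb : b * b = 1 := by decide
  have hcc : c * c = 1 := by decide
  have hab : (a * b) ^ 5 = 1 ∧ (b * a) ^ 5 = 1 := by decide
  have hac : (a * c) ^ 5 = 1 ∧ (c * a) ^ 5 = 1 := by decide
  have hbc : (b * c) ^ 3 = 1 ∧ (c * b) ^ 3 = 1 := by decide
  have hne : (a * b) ^ 2 ≠ 1 ∧ (b * a) ^ 2 ≠ 1 ∧ (b * c) ^ 2 ≠ 1 := by decide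
  have main : ∀ k : Fin 4, k ≠ 0 →
      -- The products `a * b` and `a * c` have order 5 and `b * c` has order 3, which matches the
      -- divisibility of the entries of `M`. Singling out k separates it from the other nonzero
      -- indices.
      ∃ φ : W →* Perm (Fin 5), φ (s 0) = a ∧ φ (s k) = b ∧ ∀ l, l ≠ 0 → l ≠ k → φ (s l) = c := by
    intro k hk
    let f : Fin 4 → Perm (Fin 5) := fun l ↦ if l = 0 then a else if l = k then b else c
    have hf : M.IsLiftable f := by
      intro x y
      have hdvd : ∀ {g : Perm (Fin 5)} {m n : ℕ}, g ^ m = 1 → m ∣ n → g ^ n = 1 := by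
        rintro g m _ hg ⟨q, rfl⟩
        rw [pow_mul, hg, one_pow]
      rcases eq_or_ne x y with rfl | hxy
      · rw [M.diagonal, pow_one]
        simp only [f]
        split_ifs <;> assumption
      rcases eq_or_ne x 0 with rfl | hx
      · refine hdvd ?_ (h5 y hxy.symm)
        simp only [f, if_true, hxy.symm, if_false]
        split_ifs
        exacts [hab.1, hac.1]
      rcases eq_or_ne y 0 with rfl | hy
      · refine hdvd ?_ (M.symmetric 0 x ▸ h5 x hx)
        simp only [f, if_true, hx, if_false]
        split_ifs
        exacts [hab.2, hac.2]
      · refine hdvd ?_ (h3 x y hx hy hxy)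
        simp only [f, hx, hy, if_false]
        split_ifs
        exacts [by rw [hbb, one_pow], hbc.1, hbc.2, by rw [hcc, one_pow]]
    refine ⟨cs.lift ⟨f, hf⟩, ?_, ?_, fun l hl hlk ↦ ?_⟩ <;> rw [lift_apply_simple] <;> simp [f, *]
  intro h
  rcases eq_or_ne i 0 with rfl | hi
  · obtain ⟨φ, h0, hk, -⟩ := main j hij.symm
    exact hne.1 (by rw [← h0, ← hk, ← map_mul, ← map_pow, h, map_one])
  · obtain ⟨φ, h0, hk, hl⟩ := main i hi
    rcases eq_or_ne j 0 with rfl | hj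
    · exact hne.2.1 (by rw [← h0, ← hk, ← map_mul, ← map_pow, h, map_one])
    · exact hne.2.2 (by rw [← hl j hj hij.symm, ← hk, ← map_mul, ← map_pow, h, map_one])

/-- A set of chambers containing the initial segments of its galleries, whose sectors around
codimension-two faces obey the stated lower bounds, has no nontrivial element of maximal length. -/
theorem isRightDescent_false_of_maximal (H : ∀ i j : Fin 4, i ≠ j → (s i * s j) ^ 2 ≠ 1)
    {P : Set W} (hP : ∀ p ∈ P, ∀ i, cs.IsRightDescent p i → p * s i ∈ P)
    (hP₃ : ∀ p ∈ P, ∀ i j, i ≠ j → p * s j ∉ P → p * s i ∈ P → p * s i * s j ∈ P)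
    (hP₅ : ∀ p ∈ P, ∀ i j, i ≠ j → i = 0 ∨ j = 0 → p * s j ∉ P → p * s i ∈ P →
      p * s i * s j * s i ∈ P ∧ p * s i * s j * s i * s j ∈ P)
    {L : ℕ} (hL : ∀ p ∈ P, ℓ p ≤ L) {c : W} (hc : c ∈ P) (hcL : ℓ c = L) (i : Fin 4) :
    ¬ cs.IsRightDescent c i := by
  have hnot : ∀ {c : W}, ℓ c = L → ∀ j, ¬ cs.IsRightDescent c j → c * s j ∉ P := by
    intro c hcL j hj h
    have := hL _ h
    rw [cs.not_isRightDescent_iff.1 hj] at this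
    lia
  -- the only descent of a maximal element is not `0`
  have hzero : ∀ c ∈ P, ℓ c = L → cs.IsRightDescent c 0 → ∃ j, j ≠ 0 ∧ cs.IsRightDescent c j := by
    intro c hc hcL h0
    by_contra! hD
    have hlen := cs.isRightDescent_iff.1 h0
    have h : ∀ j, j ≠ 0 → cs.IsRightDescent (c * s 0) j := by
      intro j hj
      by_contra hj'
      -- If j were an ascent of `c * s 0`, this chamber of P would have length L + 1.
      have h1 := (hP₅ c hc 0 j hj.symm (.inl rfl) (hnot hcL j (hD j hj)) (hP c hc 0 h0)).1
      have h2 := cs.length_mul_simple_mul_simple H hj hj' (cs.not_isRightDescent_mul_simple h0)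
      have := hL _ h1
      lia
    exact cs.not_isRightDescent_of_pair H (i := 1) (j := 2) (k := 3) (by decide) (by decide)
      (by decide) (h 1 (by decide)) (h 2 (by decide)) (h 3 (by decide))
  have hsingle : ∀ c ∈ P, ℓ c = L → ∀ i, i ≠ 0 → cs.IsRightDescent c i →
      (∀ j, j ≠ i → ¬ cs.IsRightDescent c j) →
      cs.IsRightDescent (c * s i) 0 ∧ cs.IsRightDescent (c * s i * s 0) i := by
    intro c hc hcL i hi hci hD
    have hlen := cs.isRightDescent_iff.1 hci
    have hci' := cs.not_isRightDescent_mul_simple hci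
    obtain ⟨h3, h4⟩ := hP₅ c hc i 0 hi (.inr rfl) (hnot hcL 0 (hD 0 hi.symm)) (hP c hc i hci)
    have h0 : cs.IsRightDescent (c * s i) 0 := by
      by_contra h0
      have h1 := cs.length_mul_simple_mul_simple H hi.symm h0 hci'
      have := hL _ h3
      lia
    refine ⟨h0, ?_⟩
    by_contra hbi
    have hb0 := cs.not_isRightDescent_mul_simple h0
    have hblen := cs.isRightDescent_iff.1 h0
    have h1 := cs.length_mul_simple_mul_simple H hi hbi hb0
    have hbi0 : ¬ cs.IsRightDescent (c * s i * s 0 * s i) 0 := by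
      intro h
      exact hb0 (by
        simpa using (IsRightDescent.alternating cs (H i 0 hi) (cs.isRightDescent_mul_simple hbi) h).1)
    -- The fifth chamber of the sector has length L - 2 + 2 = L, so `hzero` applies to it; its
    -- second descent must be i, which would make 0 a descent of `c * s i * s 0`.
    have hw0 := cs.isRightDescent_mul_simple hbi0
    obtain ⟨x, hx0, hx⟩ := hzero _ h4 (by lia) hw0
    have h5 : i = x := cs.eq_of_isRightDescent_mul_simple H hx0.symm hw0 hx (by
      simpa using cs.isRightDescent_mul_simple hbi)
    subst h5
    have h6 := (IsRightDescent.alternating cs (H 0 i hi.symm) hw0 hx).2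
    simp at h6
    exact hb0 (by simpa using h6)
  have hpair : ∀ c ∈ P, ℓ c = L → ∀ i, cs.IsRightDescent c i →
      ∃ j, j ≠ i ∧ cs.IsRightDescent c j := by
    intro c hc hcL i hci
    rcases eq_or_ne i 0 with rfl | hi
    · exact hzero c hc hcL hci
    by_contra! hD
    have hlen := cs.isRightDescent_iff.1 hci
    obtain ⟨h0, hbi⟩ := hsingle c hc hcL i hi hci hD
    -- `c * s i * s j` is another longest chamber of P. Whether or not j is its only descent, j is a
    -- descent of `c * s i * s 0`, which thus gets three descents.
    have h : ∀ j, j ≠ 0 → j ≠ i → cs.IsRightDescent (c * s i * s 0) j := by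
      intro j hj0 hji
      have hj : ¬ cs.IsRightDescent (c * s i) j := fun hj ↦
        hji (cs.eq_of_isRightDescent_mul_simple H hj0.symm h0 hj hbi).symm
      have hmem := hP₃ c hc i j hji.symm (hnot hcL j (hD j hji)) (hP c hc i hci)
      have hlen' := cs.not_isRightDescent_iff.1 hj
      have hjj := cs.isRightDescent_mul_simple hj
      by_cases hx : ∃ x, x ≠ j ∧ cs.IsRightDescent (c * s i * s j) x
      · obtain ⟨x, hxj, hx⟩ := hx
        have h1 : 0 = x := cs.eq_of_isRightDescent_mul_simple H hxj.symm hjj hx (by simpa using h0)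
        subst h1
        simpa using (IsRightDescent.alternating cs (H j 0 hj0) hjj hx).2
      · push Not at hx
        simpa using (hsingle _ hmem (by lia) j hj0 hjj hx).2
    obtain ⟨j, k, hj0, hji, hk0, hki, hjk⟩ :
        ∃ j k : Fin 4, j ≠ 0 ∧ j ≠ i ∧ k ≠ 0 ∧ k ≠ i ∧ j ≠ k := by
      clear * -
      revert i
      decide
    exact cs.not_isRightDescent_of_pair H hji.symm hki.symm hjk hbi (h j hj0 hji) (h k hk0 hki)
  intro hci
  obtain ⟨j, hji, hcj⟩ := hpair c hc hcL i hci
  have hlen := cs.isRightDescent_iff.1 hci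
  have h2 := IsRightDescent.alternating cs (H i j hji.symm) hci hcj
  -- `c * s i * s l` is again longest, so `hpair` gives it a second descent, necessarily j;
  -- alternating back makes l a descent of `c * s i * s j`.
  have h : ∀ l, l ≠ i → l ≠ j → cs.IsRightDescent (c * s i * s j) l := by
    intro l hli hlj
    have hcl := cs.not_isRightDescent_of_pair H hji.symm hli.symm hlj.symm hci hcj
    have hl : ¬ cs.IsRightDescent (c * s i) l := fun h ↦
      hlj (cs.eq_of_isRightDescent_mul_simple H hji.symm hci hcj h)
    have hmem := hP₃ c hc i l hli.symm (hnot hcL l hcl) (hP c hc i hci)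
    have hlen' := cs.not_isRightDescent_iff.1 hl
    have hll := cs.isRightDescent_mul_simple hl
    obtain ⟨x, hxl, hx⟩ := hpair _ hmem (by lia) l hll
    have h1 : j = x := cs.eq_of_isRightDescent_mul_simple H hxl.symm hll hx (by simpa using h2.1)
    subst h1
    simpa using (IsRightDescent.alternating cs (H l j hlj) hll hx).2
  obtain ⟨l, k, hli, hlj, hki, hkj, hlk⟩ :
      ∃ l k : Fin 4, l ≠ i ∧ l ≠ j ∧ k ≠ i ∧ k ≠ j ∧ l ≠ k := by
    clear * - hji
    revert i j
    decide
  exact cs.not_isRightDescent_of_pair H hli.symm hki.symm hlk h2.2 (h l hli hlj) (h k hki hkj)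

end CoxeterSystem

theorem lemma5p12 {W : Type*} [Group W] (M : CoxeterMatrix (Fin 4)) (cs : CoxeterSystem M W)
    (hodd : M.IsOddAngled)
    (k : Fin 4 → ℕ) (k' : Fin 4 → Fin 4 → ℕ)
    (hk : ∀ i : Fin 4, i ≠ 0 → 0 < k i ∧ ¬ 3 ∣ k i ∧ M 0 i = 5 * k i)
    (hk' : ∀ i j : Fin 4, i ≠ 0 → j ≠ 0 → i ≠ j → 0 < k' i j ∧ M i j = 3 * k' i j) :
    ¬ ∃ V : Subgroup W, cs.IsReflectionSubgroup V ∧ V.FiniteIndex := by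
  rintro ⟨V, ⟨hne, T, hT, hV⟩, hfin⟩
  have hM0 : ∀ i j : Fin 4, i = 0 ∨ j = 0 → i ≠ j → Odd (M i j) ∧ ¬ 3 ∣ M i j := by
    have key : ∀ i, i ≠ 0 → Odd (M 0 i) ∧ ¬ 3 ∣ M 0 i := by
      intro i hi
      obtain ⟨h1, h2, h3⟩ := hk i hi
      -- Positivity of `k i` rules out the entry 0, which encodes ∞.
      refine ⟨(hodd 0 i).resolve_left (by lia), ?_⟩
      rw [h3, Nat.prime_three.dvd_mul]
      lia
    rintro i j (rfl | rfl) hij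
    · exact key j hij.symm
    · rw [M.symmetric]
      exact key i hij
  have hModd : ∀ i j : Fin 4, i ≠ j → Odd (M i j) := by
    intro i j hij
    by_cases h : i = 0 ∨ j = 0
    · exact (hM0 i j h hij).1
    · push Not at h
      have := hk' i j h.1 h.2 hij
      exact (hodd i j).resolve_left (by lia)
  have H : ∀ i j : Fin 4, i ≠ j → (cs.simple i * cs.simple j) ^ 2 ≠ 1 := fun i j hij ↦
    cs.simple_mul_simple_sq_ne_one (fun i hi ↦ ⟨_, (hk i hi).2.2⟩)
      (fun i j hi hj hij ↦ ⟨_, (hk' i j hi hj hij).2⟩) hij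
  obtain ⟨c, hc, hmax⟩ := Set.exists_max_image (cs.fundamentalChambers V) cs.length
    (finite_fundamentalChambers hT hV) ⟨1, cs.one_mem_fundamentalChambers V⟩
  obtain ⟨i, hi⟩ : ∃ i, cs.simple i ∉ V := by
    by_contra! h
    apply hne
    rw [eq_top_iff, ← cs.subgroup_closure_range_simple, Subgroup.closure_le]
    rintro _ ⟨i, rfl⟩
    exact h i
  have hi' : cs.simple i ∈ cs.fundamentalChambers V := by
    have := (mul_simple_mem_fundamentalChambers_iff (cs.one_mem_fundamentalChambers V) i).2
      (by simpa using hi)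
    simpa using this
  have hc1 : c ≠ 1 := by
    rintro rfl
    have := hmax _ hi'
    rw [cs.length_simple, cs.length_one] at this
    lia
  obtain ⟨j, hj⟩ := cs.exists_rightDescent_of_ne_one hc1
  refine cs.isRightDescent_false_of_maximal H
    (fun p hp i h ↦ mul_simple_mem_fundamentalChambers hp h)
    (fun p hp i j hij ↦ mul_mul_mem_fundamentalChambers (hModd i j hij) hp)
    (fun p hp i j hij h ↦ mul_mul_mul_mem_fundamentalChambers (hM0 i j h hij).1 (hM0 i j h hij).2 hp)
    hmax hc rfl j hj
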